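/- Let $(p_{ij})_{1\le i,j\le K}$ be the transition matrix of an irreducible, aperiodic Markov chain on the finite state space $\Sigma=\{1,\dots,K\}$, and fix an initial state $i_0\in\Sigma$. Define nested boxes indexed by words over $\Sigma$: the box of the empty word has size $1$ and type $i_0$, and a box of type $i$ and size $s$ is split at the next generation into boxes of types $k\in\Sigma$ with sizes $s\,p_{ik}$. Thus the boxes $b_u$ of generation $n$ are indexed by the words $u\in\Sigma^n$, and their sizes $|b_u|$ sum to $1$. Let $L_n$ be the size of a size-biased pick of a box of generation $n$, that is, $L_n=|b_U|$ where $\mathbb P(U=u)=|b_u|$ for $u\in\Sigma^n$. For $\theta\in\mathbb R$ let $A(\theta)=(p_{ij}^\theta)_{i,j\in\Sigma}$, with the convention $p_{ij}^\theta=0$ if $p_{ij}=0$, and let $\rho(\theta)$ be the maximum modulus eigenvalue of $A(\theta)$, i.e. the real simple root of its characteristic polynomial whose modulus is strictly larger than that of every other complex root. This eigenvalue exists for every $\theta$, is positive, and is differentiable as a function of $\theta$. Put $$z_n(\theta)=e^{n\rho'(\theta)/\rho(\theta)},\qquad \phi(\theta)=\ln\rho(\theta)-(\theta-1)\frac{\rho'(\theta)}{\rho(\theta)},\qquad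 \psi(\theta)=\ln\rho(\theta)-\theta\,\frac{\rho'(\theta)}{\rho(\theta)}.$$ Then for every $\theta\in\mathbb R$ one has $-\infty<\phi(\theta)\le 0$, $$\lim_{\varepsilon\downarrow0}\ \lim_{n\to\infty}\frac1n\ln\mathbb P\Big(L_n\in\big(z_n(\theta)e^{-n\varepsilon},\,z_n(\theta)e^{n\varepsilon}\big)\Big)=\phi(\theta),$$ and $$\lim_{\varepsilon\downarrow0}\ \lim_{n\to\infty}\frac1n\ln\#\Big\{u\in\Sigma^n:\ |b_u|\in\big(z_n(\theta)e^{-n\varepsilon},\,z_n(\theta)e^{n\varepsilon}\big)\Big\}=\psi(\theta).$$ In both cases, for every $\varepsilon>0$ the argument of the logarithm is positive for all sufficiently large $n$, and the inner limit exists in $\mathbb R$. -/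

import Mathlib

open Filter Topology MeasureTheory

noncomputable section

namespace MarkovBoxes

/-- Aperiodicity of a transition matrix: for every state `i`, the greatest common divisor of the
possible return times `{n ≥ 1 | (p ^ n) i i > 0}` is `1`. -/
def IsAperiodic {K : ℕ} (p : Matrix (Fin K) (Fin K) ℝ) : Prop :=
  ∀ (i : Fin K) (d : ℕ), (∀ n : ℕ, 1 ≤ n → 0 < (p ^ n) i i → d ∣ n) → d = 1

/-- The matrix `A(θ) = (p_{ij}^θ)`, with the convention `p_{ij}^θ = 0` whenever `p_{ij} = 0`. -/
def powMatrix {K : ℕ} (p : Matrix (Fin K) (Fin K) ℝ) (θ : ℝ) : Matrix (Fin K) (Fin K) ℝ :=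
  Matrix.of fun i j => if p i j = 0 then 0 else p i j ^ θ

/-- `r` is a maximum modulus eigenvalue of `M`: it is a simple root of the characteristic
polynomial, and its modulus is strictly larger than that of every other complex root. -/
def IsMaxModulusEigenvalue {K : ℕ} (M : Matrix (Fin K) (Fin K) ℝ) (r : ℝ) : Prop :=
  (M.map (algebraMap ℝ ℂ)).charpoly.rootMultiplicity (r : ℂ) = 1 ∧
    ∀ z : ℂ, (M.map (algebraMap ℝ ℂ)).charpoly.IsRoot z → z ≠ (r : ℂ) → ‖z‖ < |r|

theorem IsMaxModulusEigenvalue.unique {K : ℕ} {M : Matrix (Fin K) (Fin K) ℝ} {r s : ℝ}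
    (hr : IsMaxModulusEigenvalue M r) (hs : IsMaxModulusEigenvalue M s) : r = s := by
  by_contra hne
  have root : ∀ {t : ℝ}, IsMaxModulusEigenvalue M t →
      (M.map (algebraMap ℝ ℂ)).charpoly.IsRoot (t : ℂ) := fun ht =>
    (Polynomial.rootMultiplicity_pos (Matrix.charpoly_monic _).ne_zero).1 (by rw [ht.1]; norm_num)
  have h1 := hr.2 _ (root hs) (by exact_mod_cast Ne.symm hne)
  have h2 := hs.2 _ (root hr) (by exact_mod_cast hne)
  simp only [Complex.norm_real, Real.norm_eq_abs] at h1 h2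
  exact lt_asymm h1 h2

/-- The maximum modulus eigenvalue `ρ(θ)` of `A(θ)`. -/
def rho {K : ℕ} (p : Matrix (Fin K) (Fin K) ℝ) (θ : ℝ) : ℝ :=
  Classical.epsilon fun r : ℝ => IsMaxModulusEigenvalue (powMatrix p θ) r

/-- `φ(θ) = ln ρ(θ) - (θ - 1) ρ'(θ) / ρ(θ)`. -/
def phi {K : ℕ} (p : Matrix (Fin K) (Fin K) ℝ) (θ : ℝ) : ℝ :=
  Real.log (rho p θ) - (θ - 1) * (deriv (rho p) θ / rho p θ)

/-- `ψ(θ) = ln ρ(θ) - θ ρ'(θ) / ρ(θ)`. -/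
def psi {K : ℕ} (p : Matrix (Fin K) (Fin K) ℝ) (θ : ℝ) : ℝ :=
  Real.log (rho p θ) - θ * (deriv (rho p) θ / rho p θ)

/-- The type of a box: the initial box (empty word) has type `i₀`, and the box of the word
`(i_1, …, i_n)` with `n ≥ 1` has type `i_n`. -/
def boxType {K : ℕ} (i₀ : Fin K) : (n : ℕ) → (Fin n → Fin K) → Fin K
  | 0, _ => i₀
  | n + 1, u => u (Fin.last n)

/-- The size of the box of a word: the initial box has size `1`, and a box of type `i` is split into
sub-boxes of type `k` with relative sizes `p i k`. -/
def boxSize {K : ℕ} (p : Matrix (Fin K) (Fin K) ℝ) (i₀ : Fin K) :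
    (n : ℕ) → (Fin n → Fin K) → ℝ
  | 0, _ => 1
  | n + 1, u => boxSize p i₀ n (Fin.init u) * p (boxType i₀ n (Fin.init u)) (u (Fin.last n))

/-- The law of a size-biased pick of a box of generation `n`: each box is picked with probability
equal to its size. On this space, the variable `L_n` is `boxSize p i₀ n`. -/
def sizeBiasedPick {K : ℕ} (p : Matrix (Fin K) (Fin K) ℝ) (i₀ : Fin K) (n : ℕ) :
    Measure (Fin n → Fin K) :=
  ∑ u : Fin n → Fin K, ENNReal.ofReal (boxSize p i₀ n u) • Measure.dirac u

/-- The interval `(z_n(θ) e^{-nε}, z_n(θ) e^{nε})`, where `z_n(θ) = e^{n ρ'(θ) / ρ(θ)}`. -/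
def sizeWindow {K : ℕ} (p : Matrix (Fin K) (Fin K) ℝ) (θ ε : ℝ) (n : ℕ) : Set ℝ :=
  Set.Ioo (Real.exp (n * (deriv (rho p) θ / rho p θ)) * Real.exp (-(n * ε)))
    (Real.exp (n * (deriv (rho p) θ / rho p θ)) * Real.exp (n * ε))

/-- `P(L_n ∈ (z_n(θ) e^{-nε}, z_n(θ) e^{nε}))`. -/
def windowProb {K : ℕ} (p : Matrix (Fin K) (Fin K) ℝ) (i₀ : Fin K) (θ ε : ℝ) (n : ℕ) : ℝ :=
  (sizeBiasedPick p i₀ n).real {u | boxSize p i₀ n u ∈ sizeWindow p θ ε n}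

/-- The number of boxes of generation `n` with size in `(z_n(θ) e^{-nε}, z_n(θ) e^{nε})`. -/
def windowCount {K : ℕ} (p : Matrix (Fin K) (Fin K) ℝ) (i₀ : Fin K) (θ ε : ℝ) (n : ℕ) : ℕ :=
  {u : Fin n → Fin K | boxSize p i₀ n u ∈ sizeWindow p θ ε n}.ncard

/-- `lim_{ε ↓ 0} lim_{n → ∞} (1/n) ln (a ε n) = l`: for every `ε > 0` the numbers `a ε n` are positive
for large `n` (so that their logarithms are meaningful), the inner limit exists in `ℝ`,
and the inner limits converge to `l` as `ε ↓ 0`. -/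
def HasExpRate (a : ℝ → ℕ → ℝ) (l : ℝ) : Prop :=
  ∃ g : ℝ → ℝ,
    (∀ ε : ℝ, 0 < ε → (∀ᶠ n : ℕ in atTop, 0 < a ε n) ∧
      Tendsto (fun n : ℕ => 1 / (n : ℝ) * Real.log (a ε n)) atTop (𝓝 (g ε))) ∧
    Tendsto g (𝓝[>] 0) (𝓝 l)

end MarkovBoxes

end

/-!
Weight each box of size `s` by `s ^ τ`: the weighted sum over generation `n` of `e ^ (t ln s)` is
the row sum at `i₀` of the `n`-th power of `A(τ + t)`, so by Perron–Frobenius the logarithmic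
moment generating function of the log-size, divided by `n`, converges to `t ↦ ln ρ(τ + t)`. This
limit is differentiable because the normalized Perron eigenvector of `A(θ)` is unique, hence
continuous in `θ`, and first-order perturbation then gives the derivative of the eigenvalue. The
two counting problems are the cases `τ = 1` (size-biased pick) and `τ = 0` (number of boxes) of
one local Gärtner–Ellis estimate at `t = θ - τ`.

The inner limit over `n` must exist for every fixed window, and not only when the window shrinks.
For a window `(a, b)` of slopes it is the supremum of the tangent intercepts `Λ(t) - t Λ'(t)` with
`Λ'(t) ∈ (a, b)`. Exponential tilting by each such `t` gives the lower bound; a single Chernoff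
exponent, a `t` whose slope `Λ'(t)` is the point of `[a, b]` closest to `Λ'(0)`, gives the upper
one. Comparing the two bounds on small windows shows that `Λ` lies above its tangents.
-/

open ProbabilityTheory

namespace LargeDeviations

section ExponentialGrowth

/-- The sequence `a` is eventually positive, and `a n = e^{n (L + o(1))}` as `n → ∞`.
Positivity is required because `Real.log x = ln |x|` for `x < 0` and `Real.log 0 = 0`. -/
def HasExpGrowth (a : ℕ → ℝ) (L : ℝ) : Prop :=
  (∀ᶠ n in atTop, 0 < a n) ∧
    Tendsto (fun n : ℕ => 1 / (n : ℝ) * Real.log (a n)) atTop (𝓝 L)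

variable {a b c : ℕ → ℝ} {L M : ℝ}

theorem lt_one_div_mul_log_iff {n : ℕ} {x y : ℝ} (hn : 0 < n) (hx : 0 < x) :
    y < 1 / (n : ℝ) * Real.log x ↔ Real.exp (n * y) < x := by
  rw [one_div, ← div_eq_inv_mul, lt_div_iff₀' (Nat.cast_pos.2 hn), Real.lt_log_iff_exp_lt hx]

theorem one_div_mul_log_lt_iff {n : ℕ} {x y : ℝ} (hn : 0 < n) (hx : 0 < x) :
    1 / (n : ℝ) * Real.log x < y ↔ x < Real.exp (n * y) := by
  rw [one_div, ← div_eq_inv_mul, div_lt_iff₀' (Nat.cast_pos.2 hn), Real.log_lt_iff_lt_exp hx]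

theorem hasExpGrowth_iff :
    HasExpGrowth a L ↔ (∀ α < L, ∀ᶠ n : ℕ in atTop, Real.exp (n * α) < a n) ∧
      ∀ β > L, ∀ᶠ n : ℕ in atTop, a n < Real.exp (n * β) := by
  have eventually_iff (ha : ∀ᶠ n in atTop, 0 < a n) :
      Tendsto (fun n : ℕ => 1 / (n : ℝ) * Real.log (a n)) atTop (𝓝 L) ↔
        (∀ α < L, ∀ᶠ n : ℕ in atTop, Real.exp (n * α) < a n) ∧
          ∀ β > L, ∀ᶠ n : ℕ in atTop, a n < Real.exp (n * β) := by
    rw [tendsto_order]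
    refine and_congr (forall₂_congr fun α _ => eventually_congr ?_)
      (forall₂_congr fun β _ => eventually_congr ?_)
    · filter_upwards [ha, eventually_gt_atTop 0] with n han hn
      exact lt_one_div_mul_log_iff hn han
    · filter_upwards [ha, eventually_gt_atTop 0] with n han hn
      exact one_div_mul_log_lt_iff hn han
  refine ⟨fun h => (eventually_iff h.1).1 h.2, fun h => ?_⟩
  have ha : ∀ᶠ n in atTop, 0 < a n :=
    (h.1 (L - 1) (sub_one_lt L)).mono fun n hn => (Real.exp_pos _).trans hn
  exact ⟨ha, (eventually_iff ha).2 h⟩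

theorem HasExpGrowth.eventually_exp_lt (ha : HasExpGrowth a L) {α : ℝ} (hα : α < L) :
    ∀ᶠ n : ℕ in atTop, Real.exp (n * α) < a n :=
  (hasExpGrowth_iff.1 ha).1 α hα

theorem HasExpGrowth.eventually_lt_exp (ha : HasExpGrowth a L) {β : ℝ} (hβ : L < β) :
    ∀ᶠ n : ℕ in atTop, a n < Real.exp (n * β) :=
  (hasExpGrowth_iff.1 ha).2 β hβ

theorem HasExpGrowth.mul (ha : HasExpGrowth a L) (hb : HasExpGrowth b M) :
    HasExpGrowth (fun n => a n * b n) (L + M) := by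
  refine ⟨(ha.1.and hb.1).mono fun n hn => mul_pos hn.1 hn.2, (ha.2.add hb.2).congr' ?_⟩
  filter_upwards [ha.1, hb.1] with n han hbn
  rw [Real.log_mul han.ne' hbn.ne', mul_add]

theorem HasExpGrowth.div (ha : HasExpGrowth a L) (hb : HasExpGrowth b M) :
    HasExpGrowth (fun n => a n / b n) (L - M) := by
  refine ⟨(ha.1.and hb.1).mono fun n hn => div_pos hn.1 hn.2, (ha.2.sub hb.2).congr' ?_⟩
  filter_upwards [ha.1, hb.1] with n han hbn
  rw [Real.log_div han.ne' hbn.ne', mul_sub]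

theorem hasExpGrowth_exp_nat_mul (L : ℝ) : HasExpGrowth (fun n => Real.exp (n * L)) L :=
  hasExpGrowth_iff.2 ⟨fun α hα => (eventually_gt_atTop 0).mono fun n hn => by gcongr,
    fun β hβ => (eventually_gt_atTop 0).mono fun n hn => by gcongr⟩

theorem hasExpGrowth_of_tendsto_pos {l : ℝ} (ha : Tendsto a atTop (𝓝 l)) (hl : 0 < l) :
    HasExpGrowth a 0 := by
  refine ⟨ha.eventually_const_lt hl, ?_⟩
  simpa using tendsto_one_div_atTop_nhds_zero_nat.mul (ha.log hl.ne')

theorem hasExpGrowth_const_mul_pow {C r : ℝ} (hC : 0 < C) (hr : 0 < r) :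
    HasExpGrowth (fun n => C * r ^ n) (Real.log r) := by
  have h := (hasExpGrowth_of_tendsto_pos tendsto_const_nhds hC).mul
    (hasExpGrowth_exp_nat_mul (Real.log r))
  simpa only [Real.exp_nat_mul, Real.exp_log hr, zero_add] using h

theorem HasExpGrowth.squeeze (ha : HasExpGrowth a L) (hc : HasExpGrowth c L)
    (hab : ∀ᶠ n in atTop, a n ≤ b n) (hbc : ∀ᶠ n in atTop, b n ≤ c n) : HasExpGrowth b L :=
  hasExpGrowth_iff.2
    ⟨fun _ hα => ((ha.eventually_exp_lt hα).and hab).mono fun _ h => h.1.trans_le h.2,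
      fun _ hβ => ((hc.eventually_lt_exp hβ).and hbc).mono fun _ h => h.2.trans_lt h.1⟩

theorem tendsto_exp_nat_mul_of_neg {β : ℝ} (hβ : β < 0) :
    Tendsto (fun n : ℕ => Real.exp (n * β)) atTop (𝓝 0) :=
  Real.tendsto_exp_atBot.comp (tendsto_natCast_atTop_atTop.atTop_mul_const_of_neg hβ)

end ExponentialGrowth

section ExponentialMoments

variable {Ω : Type*} [MeasurableSpace Ω] {μ : Measure Ω} {X : Ω → ℝ} {s : Set Ω} {c t : ℝ}

theorem mgf_tilted (X : Ω → ℝ) (μ : Measure Ω) (s t : ℝ) :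
    mgf X (μ.tilted fun ω => t * X ω) s = mgf X μ (t + s) / mgf X μ t := by
  simp only [mgf, integral_tilted_mul_eq_mgf, smul_eq_mul, ← integral_div, add_mul, Real.exp_add]
  exact integral_congr_ae (ae_of_all _ fun ω => by ring)

theorem integrable_exp_mul_of_mgf_pos (h : 0 < mgf X μ t) :
    Integrable (fun ω => Real.exp (t * X ω)) μ :=
  of_not_not fun hX => h.ne' (mgf_undef hX)

theorem measureReal_le_exp_neg_mul_mgf [IsFiniteMeasure μ] (ht : 0 < mgf X μ t)
    (hs : ∀ ω ∈ s, c ≤ t * X ω) : μ.real s ≤ Real.exp (-c) * mgf X μ t := by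
  have chernoff := measure_ge_le_exp_mul_mgf (X := fun ω => t * X ω) (t := 1) (μ := μ) c
    zero_le_one (by simpa only [one_mul] using integrable_exp_mul_of_mgf_pos ht)
  rw [mgf_const_mul, mul_one, neg_one_mul] at chernoff
  exact (measureReal_mono hs).trans chernoff

theorem measureReal_tilted_mul_mgf_le [IsFiniteMeasure μ] (ht : 0 < mgf X μ t)
    (hs : ∀ ω ∈ s, t * X ω ≤ c) :
    (μ.tilted fun ω => t * X ω).real s * mgf X μ t ≤ Real.exp c * μ.real s := by
  rw [← le_div_iff₀ ht, mul_div_right_comm]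
  refine ENNReal.toReal_le_of_le_ofReal (by positivity) ?_
  rw [tilted_mul_apply_mgf, ENNReal.ofReal_mul (by positivity), ofReal_measureReal,
    ← setLIntegral_const]
  exact setLIntegral_mono measurable_const fun ω hω => ENNReal.ofReal_le_ofReal <| by
    gcongr; exact hs ω hω

end ExponentialMoments

section LimitingCGF

variable {Ω : ℕ → Type*} [∀ n, MeasurableSpace (Ω n)] {X : ∀ n, Ω n → ℝ} {μ : ∀ n, Measure (Ω n)}
  {Λ : ℝ → ℝ} {D a b c t : ℝ}

/-- The Gärtner–Ellis assumption: `Λ` is the limit of the scaled cumulant generating functions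
`(1/n) ln E[e^{t X_n}]`, where the expectation is with respect to the (finite, not necessarily
normalized) measure `μ n`. -/
def HasLimitingCGF (X : ∀ n, Ω n → ℝ) (μ : ∀ n, Measure (Ω n)) (Λ : ℝ → ℝ) : Prop :=
  ∀ t, HasExpGrowth (fun n => mgf (X n) (μ n) t) (Λ t)

theorem div_natCast_mem_Ioo_iff {n : ℕ} {x : ℝ} (hn : 0 < n) :
    x / n ∈ Set.Ioo a b ↔ x ∈ Set.Ioo (n * a) (n * b) :=
  and_congr (lt_div_iff₀' (Nat.cast_pos.2 hn)) (div_lt_iff₀' (Nat.cast_pos.2 hn))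

theorem HasLimitingCGF.tilted (h : HasLimitingCGF X μ Λ) (t : ℝ) :
    HasLimitingCGF X (fun n => (μ n).tilted fun ω => t * X n ω) fun s => Λ (t + s) - Λ t := by
  intro s
  simpa only [mgf_tilted] using (h (t + s)).div (h t)

theorem HasLimitingCGF.neg (h : HasLimitingCGF X μ Λ) :
    HasLimitingCGF (fun n => -X n) μ fun t => Λ (-t) := by
  intro t
  simpa only [mgf_neg] using h (-t)

theorem HasLimitingCGF.eventually_measureReal_lt_exp [∀ n, IsFiniteMeasure (μ n)]
    (h : HasLimitingCGF X μ Λ)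
    {S : ∀ n, Set (Ω n)} (hS : ∀ n, ∀ ω ∈ S n, n * c ≤ t * X n ω) {β : ℝ} (hβ : Λ t - c < β) :
    ∀ᶠ n : ℕ in atTop, (μ n).real (S n) < Real.exp (n * β) := by
  have growth := (hasExpGrowth_exp_nat_mul (-c)).mul (h t)
  filter_upwards [growth.eventually_lt_exp (show -c + Λ t < β by linarith), (h t).1]
    with n hn hpos
  rw [mul_neg] at hn
  exact (measureReal_le_exp_neg_mul_mgf hpos (hS n)).trans_lt hn

theorem HasLimitingCGF.tendsto_measureReal_zero [∀ n, IsFiniteMeasure (μ n)]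
    (h : HasLimitingCGF X μ Λ)
    {S : ∀ n, Set (Ω n)} (hS : ∀ n, ∀ ω ∈ S n, n * c ≤ t * X n ω) (hc : Λ t < c) :
    Tendsto (fun n => (μ n).real (S n)) atTop (𝓝 0) := by
  obtain ⟨β, hβ, hβ0⟩ := exists_between (sub_neg.2 hc)
  exact squeeze_zero' (.of_forall fun n => measureReal_nonneg)
    ((h.eventually_measureReal_lt_exp hS hβ).mono fun _ => le_of_lt)
    (tendsto_exp_nat_mul_of_neg hβ0)

theorem HasLimitingCGF.tendsto_measureReal_ge [∀ n, IsFiniteMeasure (μ n)]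
    (h : HasLimitingCGF X μ Λ) (h0 : Λ 0 = 0)
    (hD : HasDerivAt Λ D 0) (hb : D < b) :
    Tendsto (fun n : ℕ => (μ n).real {ω | n * b ≤ X n ω}) atTop (𝓝 0) := by
  obtain ⟨s, hslope, hs⟩ := ((hD.tendsto_slope_zero_right.eventually_lt_const hb).and
    self_mem_nhdsWithin).exists
  rw [zero_add, h0, sub_zero, smul_eq_mul, inv_mul_lt_iff₀ hs] at hslope
  refine h.tendsto_measureReal_zero (t := s) (fun n ω hω => ?_) hslope
  rw [mul_left_comm]
  exact mul_le_mul_of_nonneg_left hω (le_of_lt hs)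

theorem HasLimitingCGF.tendsto_measureReal_le [∀ n, IsFiniteMeasure (μ n)]
    (h : HasLimitingCGF X μ Λ) (h0 : Λ 0 = 0)
    (hD : HasDerivAt Λ D 0) (ha : a < D) :
    Tendsto (fun n : ℕ => (μ n).real {ω | X n ω ≤ n * a}) atTop (𝓝 0) := by
  have hD' : HasDerivAt (fun t => Λ (-t)) (-D) 0 := by
    rw [← mul_neg_one]
    exact HasDerivAt.comp (h₂ := Λ) 0 (by rwa [neg_zero]) (hasDerivAt_neg 0)
  simpa using h.neg.tendsto_measureReal_ge (b := -a) (by rwa [neg_zero]) hD' (neg_lt_neg ha)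

theorem HasLimitingCGF.tendsto_measureReal_compl [∀ n, IsFiniteMeasure (μ n)]
    (h : HasLimitingCGF X μ Λ) (h0 : Λ 0 = 0)
    (hD : HasDerivAt Λ D 0) (hab : D ∈ Set.Ioo a b) :
    Tendsto (fun n : ℕ => (μ n).real (X n ⁻¹' Set.Ioo (n * a) (n * b))ᶜ) atTop (𝓝 0) := by
  have tails := (h.tendsto_measureReal_le h0 hD hab.1).add (h.tendsto_measureReal_ge h0 hD hab.2)
  rw [add_zero] at tails
  refine squeeze_zero (fun n => measureReal_nonneg) (fun n => ?_) tails
  refine (measureReal_mono fun ω hω => ?_).trans (measureReal_union_le _ _)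
  rw [Set.mem_compl_iff, Set.mem_preimage, Set.mem_Ioo, not_and_or, not_lt, not_lt] at hω
  exact hω

theorem HasLimitingCGF.tendsto_tilted_measureReal (h : HasLimitingCGF X μ Λ)
    (hD : HasDerivAt Λ D t) (hab : D ∈ Set.Ioo a b) :
    Tendsto (fun n : ℕ => ((μ n).tilted fun ω => t * X n ω).real
      (X n ⁻¹' Set.Ioo (n * a) (n * b))) atTop (𝓝 1) := by
  have hD' : HasDerivAt (fun s => Λ (t + s) - Λ t) D 0 :=
    (HasDerivAt.comp_const_add t 0 (by rwa [add_zero])).sub_const _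
  have compl := (h.tilted t).tendsto_measureReal_compl (by simp) hD' hab
  refine tendsto_of_tendsto_of_tendsto_of_le_of_le'
    (by simpa only [sub_zero] using compl.const_sub 1) tendsto_const_nhds ?_
    (.of_forall fun n => measureReal_le_one)
  filter_upwards [(h t).1] with n hn
  have : NeZero (μ n) := ⟨fun h0 => by simp [h0] at hn⟩
  have := isProbabilityMeasure_tilted (integrable_exp_mul_of_mgf_pos hn)
  rw [sub_le_iff_le_add, ← probReal_univ (μ := (μ n).tilted fun ω => t * X n ω),
    ← Set.union_compl_self (X n ⁻¹' Set.Ioo (n * a) (n * b))]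
  exact measureReal_union_le _ _

theorem HasLimitingCGF.eventually_exp_lt_measureReal [∀ n, IsFiniteMeasure (μ n)]
    (h : HasLimitingCGF X μ Λ)
    (hD : HasDerivAt Λ D t) (hab : D ∈ Set.Ioo a b) {α : ℝ} (hα : α < Λ t - t * D) :
    ∀ᶠ n : ℕ in atTop, Real.exp (n * α) < (μ n).real (X n ⁻¹' Set.Ioo (n * a) (n * b)) := by
  obtain ⟨c, hDc, hc⟩ := exists_between (show t * D < Λ t - α by linarith)
  obtain ⟨a', b', hab', hsub⟩ := mem_nhds_iff_exists_Ioo_subset.1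
    (inter_mem (Ioo_mem_nhds hab.1 hab.2)
      ((continuous_const_mul t).tendsto D |>.eventually_lt_const hDc))
  have growth := ((hasExpGrowth_of_tendsto_pos (h.tendsto_tilted_measureReal hD hab')
    one_pos).mul (h t)).div (hasExpGrowth_exp_nat_mul c)
  filter_upwards [growth.eventually_exp_lt (show α < 0 + Λ t - c by linarith), (h t).1,
    eventually_gt_atTop 0] with n hn hpos hn0
  have window : ∀ ω ∈ X n ⁻¹' Set.Ioo (n * a') (n * b'),
      X n ω / n ∈ Set.Ioo a b ∧ t * (X n ω / n) < c := fun ω hω =>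
    hsub ((div_natCast_mem_Ioo_iff hn0).2 hω)
  have tilted_le := measureReal_tilted_mul_mgf_le (c := n * c) hpos fun ω hω => by
    have := (window ω hω).2
    rw [← mul_div_assoc, div_lt_iff₀' (Nat.cast_pos.2 hn0)] at this
    exact this.le
  rw [lt_div_iff₀' (Real.exp_pos _)] at hn
  exact (lt_of_mul_lt_mul_left (hn.trans_le tilted_le) (Real.exp_nonneg _)).trans_le
    (measureReal_mono fun ω hω => (div_natCast_mem_Ioo_iff hn0).1 (window ω hω).1)

theorem HasLimitingCGF.eventually_window_lt_exp [∀ n, IsFiniteMeasure (μ n)]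
    (h : HasLimitingCGF X μ Λ) {L β : ℝ} (hL : ∀ y ∈ Set.Ioo a b, Λ t - t * y ≤ L) (hβ : L < β) :
    ∀ᶠ n : ℕ in atTop, (μ n).real (X n ⁻¹' Set.Ioo (n * a) (n * b)) < Real.exp (n * β) := by
  refine h.eventually_measureReal_lt_exp (t := t) (c := Λ t - L) (fun n ω hω => ?_) (by linarith)
  rcases n.eq_zero_or_pos with rfl | hn
  · simp at hω
  · have := hL _ ((div_natCast_mem_Ioo_iff hn).2 hω)
    rw [← le_div_iff₀' (Nat.cast_pos.2 hn), mul_div_assoc]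
    linarith

theorem HasLimitingCGF.sub_mul_deriv_le [∀ n, IsFiniteMeasure (μ n)]
    (h : HasLimitingCGF X μ Λ) (hD : HasDerivAt Λ D t) (s : ℝ) : Λ t - t * D ≤ Λ s - s * D := by
  by_contra! hlt
  obtain ⟨L, hsL, hLt⟩ := exists_between hlt
  obtain ⟨β, hLβ, hβt⟩ := exists_between hLt
  have near : ∀ᶠ y in 𝓝 D, Λ s - s * y < L :=
    (Continuous.tendsto (by fun_prop : Continuous fun y => Λ s - s * y) D).eventually_lt_const hsL
  obtain ⟨a, b, hab, hsub⟩ := mem_nhds_iff_exists_Ioo_subset.1 near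
  obtain ⟨n, lower, upper⟩ := ((h.eventually_exp_lt_measureReal hD hab hβt).and
    (h.eventually_window_lt_exp (fun y hy => (hsub hy).le) hLβ)).exists
  exact lower.not_gt upper

end LimitingCGF

section LegendreDuality

variable {f : ℝ → ℝ} {a b L : ℝ}

/-- The intercepts (values at `0`) of the tangents of `f` with slope in `I`. For convex `f` this is
the image under `-f*` of the slopes in `I` that are attained, `f*` being the Legendre transform. -/
def tangentIntercepts (f : ℝ → ℝ) (I : Set ℝ) : Set ℝ :=
  (fun s => f s - s * deriv f s) '' (deriv f ⁻¹' I)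

theorem monotone_deriv_of_tangent_le (htan : ∀ s t, f t - t * deriv f t ≤ f s - s * deriv f t) :
    Monotone (deriv f) := by
  intro s t hst
  rcases hst.eq_or_lt with rfl | hst
  · exact le_rfl
  · have : 0 ≤ (t - s) * (deriv f t - deriv f s) := by linarith [htan s t, htan t s]
    exact sub_nonneg.1 (nonneg_of_mul_nonneg_right this (sub_pos.2 hst))

theorem exists_sub_mul_le_of_le_deriv_zero (hf : Differentiable ℝ f)
    (htan : ∀ s t, f t - t * deriv f t ≤ f s - s * deriv f t)
    (hL : IsLUB (tangentIntercepts f (Set.Ioo a b)) L) (hb : b ≤ deriv f 0) :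
    ∃ t, ∀ y ∈ Set.Ioo a b, f t - t * y ≤ L := by
  obtain ⟨_, θ, hθ, -⟩ := hL.nonempty
  have hθ0 : θ ≤ 0 := le_of_lt <| (monotone_deriv_of_tangent_le htan).reflect_lt (hθ.2.trans_le hb)
  have darboux (l r : ℝ) (hlr : l ≤ r) {m : ℝ} (hl : deriv f l ≤ m) (hr : m ≤ deriv f r) :
      ∃ s ∈ Set.Icc l r, deriv f s = m :=
    exists_hasDerivWithinAt_eq_of_ge_of_le hlr
      (fun s _ => (hf s).hasDerivAt.hasDerivWithinAt) hl hr
  obtain ⟨t, ht, rfl⟩ := darboux θ 0 hθ0 hθ.2.le hb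
  have approx : ∀ y ∈ Set.Ioo (deriv f θ) (deriv f t),
      f t - t * deriv f t + θ * (deriv f t - y) ≤ L := by
    intro y hy
    obtain ⟨s, hs, rfl⟩ := darboux θ t ht.1 hy.1.le hy.2.le
    have := hL.1 ⟨s, ⟨hθ.1.trans hy.1, hy.2⟩, rfl⟩
    have := mul_le_mul_of_nonneg_right hs.1 (sub_nonneg.2 hy.2.le)
    linarith [htan s t]
  have limit : f t - t * deriv f t ≤ L := by
    have cont : Continuous fun y => f t - t * deriv f t + θ * (deriv f t - y) := by fun_prop
    refine le_of_tendsto (f := fun y => f t - t * deriv f t + θ * (deriv f t - y))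
      (x := 𝓝[<] deriv f t) ?_ (mem_of_superset (Ioo_mem_nhdsLT hθ.2) approx)
    simpa using (cont.tendsto (deriv f t)).mono_left nhdsWithin_le_nhds
  refine ⟨t, fun y hy => ?_⟩
  linarith [mul_le_mul_of_nonpos_left hy.2.le ht.2]

theorem tangentIntercepts_comp_neg (f : ℝ → ℝ) (a b : ℝ) :
    tangentIntercepts (fun x => f (-x)) (Set.Ioo (-b) (-a)) =
      tangentIntercepts f (Set.Ioo a b) := by
  ext c
  constructor <;> rintro ⟨s, hs, rfl⟩ <;> refine ⟨-s, ?_, ?_⟩ <;>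
    simp_all [deriv_comp_neg, neg_lt, lt_neg]

theorem exists_sub_mul_le_of_isLUB (hf : Differentiable ℝ f)
    (htan : ∀ s t, f t - t * deriv f t ≤ f s - s * deriv f t)
    (hL : IsLUB (tangentIntercepts f (Set.Ioo a b)) L) :
    ∃ t, ∀ y ∈ Set.Ioo a b, f t - t * y ≤ L := by
  rcases le_or_gt b (deriv f 0) with hb | hb
  · exact exists_sub_mul_le_of_le_deriv_zero hf htan hL hb
  rcases le_or_gt (deriv f 0) a with ha | ha
  · rw [← tangentIntercepts_comp_neg] at hL
    obtain ⟨t, ht⟩ := exists_sub_mul_le_of_le_deriv_zero (f := fun x => f (-x))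
      (hf.comp differentiable_neg)
      (fun s t => by simpa [deriv_comp_neg] using htan (-s) (-t)) hL (by simpa [deriv_comp_neg])
    exact ⟨-t, fun y hy => by simpa using ht (-y) ⟨neg_lt_neg hy.2, neg_lt_neg hy.1⟩⟩
  · exact ⟨0, fun y _ => by simpa using hL.1 ⟨0, ⟨ha, hb⟩, rfl⟩⟩

end LegendreDuality

section GartnerEllis

variable {Ω : ℕ → Type*} [∀ n, MeasurableSpace (Ω n)] {X : ∀ n, Ω n → ℝ} {μ : ∀ n, Measure (Ω n)}
  [∀ n, IsFiniteMeasure (μ n)] {Λ : ℝ → ℝ} {a b : ℝ}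

theorem HasLimitingCGF.hasExpGrowth_of_isLUB (h : HasLimitingCGF X μ Λ) (hΛ : Differentiable ℝ Λ)
    {L : ℝ} (hL : IsLUB (tangentIntercepts Λ (Set.Ioo a b)) L) :
    HasExpGrowth (fun n : ℕ => (μ n).real (X n ⁻¹' Set.Ioo (n * a) (n * b))) L := by
  refine hasExpGrowth_iff.2 ⟨fun α hα => ?_, fun β hβ => ?_⟩
  · obtain ⟨_, ⟨s, hs, rfl⟩, hα⟩ := (lt_isLUB_iff hL).1 hα
    exact h.eventually_exp_lt_measureReal (hΛ s).hasDerivAt hs hα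
  · obtain ⟨t, ht⟩ := exists_sub_mul_le_of_isLUB hΛ
      (fun s t => h.sub_mul_deriv_le (hΛ t).hasDerivAt s) hL
    exact h.eventually_window_lt_exp ht hβ

theorem HasLimitingCGF.hasExpRate (h : HasLimitingCGF X μ Λ) (hΛ : Differentiable ℝ Λ) (t : ℝ) :
    MarkovBoxes.HasExpRate (fun ε n => (μ n).real
        (X n ⁻¹' Set.Ioo (n * (deriv Λ t - ε)) (n * (deriv Λ t + ε))))
      (Λ t - t * deriv Λ t) := by
  have tangent_le (s t : ℝ) := h.sub_mul_deriv_le (hΛ t).hasDerivAt s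
  set J : ℝ → Set ℝ := fun ε =>
    tangentIntercepts Λ (Set.Ioo (deriv Λ t - ε) (deriv Λ t + ε))
  have mem_J : ∀ ε > 0, Λ t - t * deriv Λ t ∈ J ε := fun ε hε =>
    ⟨t, ⟨sub_lt_self _ hε, lt_add_of_pos_right _ hε⟩, rfl⟩
  have J_le : ∀ ε, ∀ c ∈ J ε, c ≤ Λ t - t * deriv Λ t + |t| * ε := by
    rintro ε _ ⟨s, hs, rfl⟩
    have : |deriv Λ t - deriv Λ s| ≤ ε := abs_le.2 ⟨by linarith [hs.2], by linarith [hs.1]⟩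
    have : t * (deriv Λ t - deriv Λ s) ≤ |t| * ε :=
      (le_abs_self _).trans ((abs_mul _ _).trans_le (by gcongr))
    have := tangent_le t s
    dsimp only
    linarith
  have hsSup : ∀ ε > 0, IsLUB (J ε) (sSup (J ε)) := fun ε hε =>
    isLUB_csSup ⟨_, mem_J ε hε⟩ ⟨_, J_le ε⟩
  refine ⟨fun ε => sSup (J ε), fun ε hε => h.hasExpGrowth_of_isLUB hΛ (hsSup ε hε), ?_⟩
  have cont : Continuous fun ε => Λ t - t * deriv Λ t + |t| * ε := by fun_prop
  refine tendsto_of_tendsto_of_tendsto_of_le_of_le' tendsto_const_nhds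
    (by simpa using (cont.tendsto 0).mono_left nhdsWithin_le_nhds)
    (eventually_mem_nhdsWithin.mono fun ε hε => (hsSup ε hε).1 (mem_J ε hε))
    (eventually_mem_nhdsWithin.mono fun ε hε => (hsSup ε hε).2 (J_le ε))

end GartnerEllis

end LargeDeviations

namespace PerronFrobenius

open Matrix

variable {n : Type*} [Fintype n]

section Positivity

variable {A B : Matrix n n ℝ} {r s : ℝ} {u v w x : n → ℝ}

theorem exists_pos_forall_mul_le {ι : Type*} [Finite ι] (u : ι → ℝ) {v : ι → ℝ}
    (hv : ∀ i, 0 < v i) : ∃ e > 0, ∀ i, e * u i ≤ v i := by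
  have small : ∀ i, ∀ᶠ e in 𝓝[>] (0 : ℝ), e * u i ≤ v i := fun i => by
    have cont : Tendsto (fun e => e * u i) (𝓝[>] (0 : ℝ)) (𝓝 0) := by
      simpa using ((continuous_mul_const (u i)).tendsto 0).mono_left nhdsWithin_le_nhds
    exact (cont.eventually_lt_const (hv i)).mono fun _ => le_of_lt
  exact (eventually_mem_nhdsWithin.and (eventually_all.2 small)).exists

theorem dotProduct_pos (hw : ∀ i, 0 < w i) (hx : 0 ≤ x) (hx0 : x ≠ 0) : 0 < w ⬝ᵥ x := by
  obtain ⟨j, hj⟩ := Function.ne_iff.1 hx0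
  exact (Finset.sum_pos_iff_of_nonneg fun i _ => mul_nonneg (hw i).le (hx i)).2
    ⟨j, Finset.mem_univ j, mul_pos (hw j) ((hx j).lt_of_ne' hj)⟩

theorem mulVec_mono (hA : ∀ i j, 0 ≤ A i j) (huv : u ≤ v) : A *ᵥ u ≤ A *ᵥ v :=
  fun i => dotProduct_le_dotProduct_of_nonneg_left huv (hA i)

theorem ne_zero_of_mem_stdSimplex (hx : x ∈ stdSimplex ℝ n) : x ≠ 0 := by
  rintro rfl
  simpa using hx.2

theorem eigenvalue_eq_of_dotProduct_ne_zero (hwx : w ⬝ᵥ x ≠ 0) (hx : A *ᵥ x = s • x)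
    (hw : w ᵥ* A = r • w) : s = r := by
  have h := dotProduct_mulVec w A x
  rw [hx, hw, dotProduct_smul, smul_dotProduct] at h
  exact mul_right_cancel₀ hwx h

variable [DecidableEq n]

theorem pow_mulVec_eq {R : Type*} [CommSemiring R] {A : Matrix n n R} {x : n → R} {r : R}
    (h : A *ᵥ x = r • x) (k : ℕ) : A ^ k *ᵥ x = r ^ k • x := by
  induction k with
  | zero => simp
  | succ k ih => rw [pow_succ, ← mulVec_mulVec, h, mulVec_smul, ih, smul_smul, pow_succ']

theorem vecMul_pow_eq {R : Type*} [CommSemiring R] {A : Matrix n n R} {w : n → R} {r : R}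
    (h : w ᵥ* A = r • w) (k : ℕ) : w ᵥ* A ^ k = r ^ k • w := by
  rw [← transpose_transpose (A ^ k), vecMul_transpose, transpose_pow]
  exact pow_mulVec_eq (by rwa [mulVec_transpose]) k

theorem pow_add_apply_pos (hA : ∀ i j, 0 ≤ A i j) {a b : ℕ} {i j l : n}
    (hij : 0 < (A ^ a) i j) (hjl : 0 < (A ^ b) j l) : 0 < (A ^ (a + b)) i l := by
  rw [pow_add, mul_apply]
  exact (Finset.sum_pos_iff_of_nonneg fun m _ =>
    mul_nonneg (pow_apply_nonneg hA a i m) (pow_apply_nonneg hA b m l)).2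
      ⟨j, Finset.mem_univ j, mul_pos hij hjl⟩

theorem pow_apply_pos_of_pos_imp (hA : ∀ i j, 0 ≤ A i j) (hB : ∀ i j, 0 ≤ B i j)
    (hBA : ∀ i j, 0 < B i j → 0 < A i j) (k : ℕ) {i j : n} (h : 0 < (B ^ k) i j) :
    0 < (A ^ k) i j := by
  induction k generalizing j with
  | zero => simpa using h
  | succ k ih =>
    rw [pow_succ, mul_apply, Finset.sum_pos_iff_of_nonneg fun l _ =>
      mul_nonneg (pow_apply_nonneg hB k i l) (hB l j)] at h
    obtain ⟨l, -, hl⟩ := h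
    refine pow_add_apply_pos hA (ih (pos_of_mul_pos_left hl (hB l j))) ?_
    rw [pow_one]
    exact hBA l j (pos_of_mul_pos_right hl (pow_apply_nonneg hB k i l))

theorem isPrimitive_of_pos_imp (hB : B.IsPrimitive) (hA : ∀ i j, 0 ≤ A i j)
    (hBA : ∀ i j, 0 < B i j → 0 < A i j) : A.IsPrimitive :=
  let ⟨k, hk, hpos⟩ := hB.exists_pos_pow
  ⟨hA, k, hk, fun i j => pow_apply_pos_of_pos_imp hA hB.nonneg hBA k (hpos i j)⟩

theorem isPrimitive_transpose (hA : A.IsPrimitive) : Aᵀ.IsPrimitive :=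
  let ⟨k, hk, hpos⟩ := hA.exists_pos_pow
  ⟨fun i j => hA.nonneg j i, k, hk, fun i j => by rw [← transpose_pow]; exact hpos j i⟩

theorem eventually_pow_apply_self_pos (hA : ∀ i j, 0 ≤ A i j) {i : n}
    (hgcd : Nat.setGcd {m | 0 < (A ^ m) i i} = 1) : ∀ᶠ m in atTop, 0 < (A ^ m) i i := by
  let returnTimes : AddSubmonoid ℕ :=
    { carrier := {m | 0 < (A ^ m) i i}
      zero_mem' := by simp
      add_mem' := pow_add_apply_pos hA }
  obtain ⟨N, hN⟩ := Nat.exists_mem_closure_of_ge (returnTimes : Set ℕ)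
  filter_upwards [eventually_ge_atTop N] with m hm
  have := hN m hm (hgcd ▸ one_dvd m)
  rwa [AddSubmonoid.closure_eq] at this

theorem isPrimitive_of_isIrreducible (hA : A.IsIrreducible)
    (hgcd : ∀ i, Nat.setGcd {m | 0 < (A ^ m) i i} = 1) : A.IsPrimitive := by
  have eventually_pos (i j : n) : ∀ᶠ m in atTop, 0 < (A ^ m) i j := by
    obtain ⟨k, -, hk⟩ := (isIrreducible_iff_exists_pow_pos hA.nonneg).1 hA i j
    filter_upwards [(tendsto_sub_atTop_nat k).eventually
      (eventually_pow_apply_self_pos hA.nonneg (hgcd i)), eventually_ge_atTop k] with m hm hkm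
    simpa only [Nat.sub_add_cancel hkm] using pow_add_apply_pos hA.nonneg hm hk
  obtain ⟨m, hm, hpos⟩ := ((eventually_gt_atTop 0).and
    (eventually_all.2 fun i => eventually_all.2 (eventually_pos i))).exists
  exact ⟨hA.nonneg, m, hm, hpos⟩

end Positivity

section CollatzWielandt

variable {A : Matrix n n ℝ} {l : ℝ} {y : n → ℝ}

/-- The pairs `(l, y)` of Collatz and Wielandt: `l` is a nonnegative number and `y` a probability
vector with `l y ≤ A y`. The Perron eigenvalue of `A` is the largest such `l`. -/
def subinvariantPairs (A : Matrix n n ℝ) : Set (ℝ × (n → ℝ)) :=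
  {q | 0 ≤ q.1 ∧ q.2 ∈ stdSimplex ℝ n ∧ q.1 • q.2 ≤ A *ᵥ q.2}

theorem isCompact_subinvariantPairs (A : Matrix n n ℝ) : IsCompact (subinvariantPairs A) := by
  have cont : Continuous fun y : n → ℝ => A *ᵥ y := by fun_prop
  have simplex_compact := isCompact_stdSimplex ℝ n
  obtain ⟨M, hM⟩ := simplex_compact.bddAbove_image
    (continuous_finsetSum Finset.univ fun i _ => (continuous_apply i).comp cont).continuousOn
  refine (isCompact_Icc (a := 0) (b := M) |>.prod simplex_compact).of_isClosed_subset ?_ ?_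
  · exact (isClosed_le continuous_const continuous_fst).inter <|
      (simplex_compact.isClosed.preimage continuous_snd).inter <|
        isClosed_le (by fun_prop) (cont.comp continuous_snd)
  · rintro ⟨l, y⟩ ⟨hl, hy, hle⟩
    refine ⟨⟨hl, ?_⟩, hy⟩
    calc l = ∑ i, l * y i := by rw [← Finset.mul_sum, hy.2, mul_one]
      _ ≤ ∑ i, (A *ᵥ y) i := Finset.sum_le_sum fun i _ => hle i
      _ ≤ M := hM ⟨y, hy, rfl⟩

theorem nonempty_subinvariantPairs [Nonempty n] (hA : ∀ i j, 0 ≤ A i j) :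
    (subinvariantPairs A).Nonempty := by
  classical
  obtain ⟨i⟩ := ‹Nonempty n›
  refine ⟨(0, Pi.single i 1), le_rfl, single_mem_stdSimplex ℝ i, ?_⟩
  rw [zero_smul, ← mulVec_zero A]
  exact mulVec_mono hA (single_mem_stdSimplex ℝ i).1

theorem inv_sum_smul_mem_subinvariantPairs (hl : 0 ≤ l) (hy : 0 ≤ y) (hy0 : 0 < ∑ i, y i)
    (hle : l • y ≤ A *ᵥ y) : (l, (∑ i, y i)⁻¹ • y) ∈ subinvariantPairs A := by
  refine ⟨hl, ⟨fun i => mul_nonneg (inv_nonneg.2 hy0.le) (hy i), ?_⟩, ?_⟩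
  · simp only [Pi.smul_apply, smul_eq_mul, ← Finset.mul_sum, inv_mul_cancel₀ hy0.ne']
  · rw [mulVec_smul, smul_comm]
    exact smul_le_smul_of_nonneg_left hle (inv_nonneg.2 hy0.le)

variable [DecidableEq n] [Nonempty n]

theorem exists_lt_mem_subinvariantPairs (hA : A.IsPrimitive) (h : (l, y) ∈ subinvariantPairs A)
    (hne : A *ᵥ y ≠ l • y) : ∃ q ∈ subinvariantPairs A, l < q.1 := by
  obtain ⟨hl, hy, hle⟩ := h
  obtain ⟨k, -, hpos⟩ := hA.exists_pos_pow
  have improved_pos (i : n) : 0 < (A ^ k *ᵥ y) i :=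
    dotProduct_pos (hpos i) hy.1 (ne_zero_of_mem_stdSimplex hy)
  have gap_pos (i : n) : 0 < (A ^ k *ᵥ (A *ᵥ y - l • y)) i :=
    dotProduct_pos (hpos i) (sub_nonneg.2 hle) (sub_ne_zero.2 hne)
  obtain ⟨e, he, hgap⟩ := exists_pos_forall_mul_le (A ^ k *ᵥ y) gap_pos
  refine ⟨_, inv_sum_smul_mem_subinvariantPairs (l := l + e) (y := A ^ k *ᵥ y) (by positivity)
    (fun i => (improved_pos i).le)
    (Finset.sum_pos (fun i _ => improved_pos i) Finset.univ_nonempty) fun i => ?_,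
    lt_add_of_pos_right l he⟩
  have := hgap i
  rw [mulVec_sub, mulVec_smul, mulVec_mulVec, pow_mul_comm', ← mulVec_mulVec] at this
  rw [add_smul]
  exact le_sub_iff_add_le'.1 this

theorem exists_pos_eigenvector (hA : A.IsPrimitive) :
    ∃ r : ℝ, 0 < r ∧ ∃ x ∈ stdSimplex ℝ n, (∀ i, 0 < x i) ∧ A *ᵥ x = r • x := by
  obtain ⟨⟨r, x⟩, hrx, hmax⟩ := (isCompact_subinvariantPairs A).exists_isMaxOn
    (nonempty_subinvariantPairs hA.nonneg) continuous_fst.continuousOn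
  have eigen : A *ᵥ x = r • x := by
    by_contra hne
    obtain ⟨q, hq, hlt⟩ := exists_lt_mem_subinvariantPairs hA hrx hne
    exact hlt.not_ge (hmax hq)
  obtain ⟨hr, hx, -⟩ := hrx
  obtain ⟨k, hk, hpos⟩ := hA.exists_pos_pow
  have pow_pos (i : n) : 0 < r ^ k * x i := by
    have : 0 < (A ^ k *ᵥ x) i := dotProduct_pos (hpos i) hx.1 (ne_zero_of_mem_stdSimplex hx)
    rwa [pow_mulVec_eq eigen] at this
  have r_ne_zero : r ≠ 0 := by
    rintro rfl
    simpa [hk.ne'] using pow_pos (Classical.arbitrary n)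
  exact ⟨r, hr.lt_of_ne' r_ne_zero, x, hx,
    fun i => pos_of_mul_pos_right (pow_pos i) (pow_nonneg hr k), eigen⟩

end CollatzWielandt

section PerronTriple

variable {A : Matrix n n ℝ} {r : ℝ} {w x : n → ℝ}

/-- `r` is a positive eigenvalue of `A` with a positive right eigenvector `x` and a positive left
eigenvector `w`. For primitive `A` this determines `r`, and `x` and `w` up to scaling. -/
structure IsPerronTriple (A : Matrix n n ℝ) (r : ℝ) (x w : n → ℝ) : Prop where
  pos : 0 < r
  right_pos : ∀ i, 0 < x i
  left_pos : ∀ i, 0 < w i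
  mulVec_eq : A *ᵥ x = r • x
  vecMul_eq : w ᵥ* A = r • w

theorem IsPerronTriple.dotProduct_pos [Nonempty n] (h : IsPerronTriple A r x w) : 0 < w ⬝ᵥ x :=
  Finset.sum_pos (fun i _ => mul_pos (h.left_pos i) (h.right_pos i)) Finset.univ_nonempty

variable [DecidableEq n]

theorem exists_isPerronTriple [Nonempty n] (hA : A.IsPrimitive) :
    ∃ r, ∃ x ∈ stdSimplex ℝ n, ∃ w, IsPerronTriple A r x w := by
  obtain ⟨r, hr, x, hx, hxpos, hAx⟩ := exists_pos_eigenvector hA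
  obtain ⟨s, -, w, -, hwpos, hwA⟩ := exists_pos_eigenvector (isPrimitive_transpose hA)
  rw [mulVec_transpose] at hwA
  obtain rfl := eigenvalue_eq_of_dotProduct_ne_zero
    (dotProduct_pos hwpos hx.1 (ne_zero_of_mem_stdSimplex hx)).ne' hAx hwA
  exact ⟨r, x, hx, w, hr, hxpos, hwpos, hAx, hwA⟩

theorem IsPerronTriple.hasExpGrowth_pow_mulVec_one (h : IsPerronTriple A r x w)
    (hA : ∀ i j, 0 ≤ A i j) (i : n) :
    LargeDeviations.HasExpGrowth (fun k => (A ^ k *ᵥ 1) i) (Real.log r) := by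
  obtain ⟨c, hc, hc_le⟩ := exists_pos_forall_mul_le x (v := 1) fun _ => one_pos
  obtain ⟨C, hC, hC_le⟩ := exists_pos_forall_mul_le 1 h.right_pos
  have pow_smul (e : ℝ) (k : ℕ) : (A ^ k *ᵥ (e • x)) i = e * x i * r ^ k := by
    rw [mulVec_smul, pow_mulVec_eq h.mulVec_eq, Pi.smul_apply, Pi.smul_apply, smul_eq_mul,
      smul_eq_mul]
    ring
  refine .squeeze (LargeDeviations.hasExpGrowth_const_mul_pow (mul_pos hc (h.right_pos i)) h.pos)
    (LargeDeviations.hasExpGrowth_const_mul_pow (mul_pos (inv_pos.2 hC) (h.right_pos i)) h.pos)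
    (.of_forall fun k => ?_) (.of_forall fun k => ?_)
  · rw [← pow_smul]
    exact mulVec_mono (pow_apply_nonneg hA k) hc_le i
  · rw [← pow_smul]
    refine mulVec_mono (pow_apply_nonneg hA k) (fun j => ?_) i
    exact (le_inv_mul_iff₀ hC).2 (hC_le j)

end PerronTriple

section SpectralGap

variable {𝕜 : Type*} [RCLike 𝕜] {A B : Matrix n n ℝ} {r s : ℝ} {w x y : n → ℝ}

theorem norm_map_mulVec_le (hB : ∀ i j, 0 ≤ B i j) (v : n → 𝕜) :
    (fun i => ‖(B.map (algebraMap ℝ 𝕜) *ᵥ v) i‖) ≤ B *ᵥ fun j => ‖v j‖ := fun i =>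
  (norm_sum_le _ _).trans_eq <| Finset.sum_congr rfl fun j _ => by
    simp only [norm_mul, map_apply, norm_algebraMap', Real.norm_of_nonneg (hB i j)]

-- Subtracting from each column a multiple of the corresponding entry of `w` keeps `B` nonnegative
-- and does not change its action on the kernel of `w`, but lowers the eigenvalue of `w`.
theorem exists_lt_forall_dotProduct_norm_le [Nonempty n] (hB : ∀ i j, 0 < B i j)
    (hw : ∀ i, 0 < w i) (hwB : w ᵥ* B = s • w) :
    ∃ δ < s, ∀ v : n → 𝕜, (algebraMap ℝ 𝕜 ∘ w) ⬝ᵥ v = 0 →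
      (w ⬝ᵥ fun i => ‖(B.map (algebraMap ℝ 𝕜) *ᵥ v) i‖) ≤ δ * (w ⬝ᵥ fun j => ‖v j‖) := by
  obtain ⟨e, he, hle⟩ := exists_pos_forall_mul_le (fun q : n × n => w q.2) (v := fun q => B q.1 q.2)
    fun q => hB q.1 q.2
  have sum_pos : 0 < w ⬝ᵥ 1 := by
    simpa only [dotProduct_one] using Finset.sum_pos (fun i _ => hw i) Finset.univ_nonempty
  refine ⟨s - e * (w ⬝ᵥ 1), sub_lt_self s (mul_pos he sum_pos), fun v hv => ?_⟩
  set C := B - vecMulVec 1 (e • w) with hC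
  have mulVec_eq : B.map (algebraMap ℝ 𝕜) *ᵥ v = C.map (algebraMap ℝ 𝕜) *ᵥ v := by
    have map_C : C.map (algebraMap ℝ 𝕜)
        = B.map (algebraMap ℝ 𝕜) - vecMulVec 1 ((e : 𝕜) • (algebraMap ℝ 𝕜 ∘ w)) := by
      ext i j
      simp [hC]
    rw [map_C, sub_mulVec, vecMulVec_mulVec, smul_dotProduct, hv]
    simp
  have vecMul_eq : w ᵥ* C = (s - e * (w ⬝ᵥ 1)) • w := by
    rw [hC, vecMul_sub, hwB, vecMul_vecMulVec, sub_smul, smul_smul, mul_comm]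
  calc (w ⬝ᵥ fun i => ‖(B.map (algebraMap ℝ 𝕜) *ᵥ v) i‖)
      ≤ w ⬝ᵥ (C *ᵥ fun j => ‖v j‖) := by
        rw [mulVec_eq]
        refine dotProduct_le_dotProduct_of_nonneg_left (norm_map_mulVec_le (fun i j => ?_) v)
          fun i => (hw i).le
        simpa [hC, vecMulVec_apply] using hle (i, j)
    _ = (s - e * (w ⬝ᵥ 1)) * (w ⬝ᵥ fun j => ‖v j‖) := by
        rw [dotProduct_mulVec, vecMul_eq, smul_dotProduct, smul_eq_mul]

theorem IsPerronTriple.dotProduct_map_mulVec (h : IsPerronTriple A r x w) (v : n → 𝕜) :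
    (algebraMap ℝ 𝕜 ∘ w) ⬝ᵥ (A.map (algebraMap ℝ 𝕜) *ᵥ v)
      = r * ((algebraMap ℝ 𝕜 ∘ w) ⬝ᵥ v) := by
  have vecMul_map : (algebraMap ℝ 𝕜 ∘ w) ᵥ* A.map (algebraMap ℝ 𝕜)
      = (r : 𝕜) • (algebraMap ℝ 𝕜 ∘ w) := by
    ext j
    rw [← RingHom.map_vecMul, h.vecMul_eq]
    simp
  rw [dotProduct_mulVec, vecMul_map, smul_dotProduct, smul_eq_mul]

variable [DecidableEq n] [Nonempty n]

theorem IsPerronTriple.norm_lt (h : IsPerronTriple A r x w) (hA : A.IsPrimitive) {z : 𝕜}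
    {v : n → 𝕜} (hv : v ≠ 0) (hz : A.map (algebraMap ℝ 𝕜) *ᵥ v = z • v)
    (hwv : (algebraMap ℝ 𝕜 ∘ w) ⬝ᵥ v = 0) : ‖z‖ < r := by
  obtain ⟨k, -, hpos⟩ := hA.exists_pos_pow
  obtain ⟨δ, hδ, hcontr⟩ := exists_lt_forall_dotProduct_norm_le (𝕜 := 𝕜) hpos h.left_pos
    (vecMul_pow_eq h.vecMul_eq k)
  have norm_pos : 0 < w ⬝ᵥ fun j => ‖v j‖ :=
    PerronFrobenius.dotProduct_pos h.left_pos (fun j => norm_nonneg (v j)) fun h0 =>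
      hv (funext fun j => norm_eq_zero.1 (congrFun h0 j))
  have norm_pow (i : n) : ‖((A ^ k).map (algebraMap ℝ 𝕜) *ᵥ v) i‖ = ‖z‖ ^ k * ‖v i‖ := by
    rw [Matrix.map_pow, pow_mulVec_eq hz, Pi.smul_apply, smul_eq_mul, norm_mul, _root_.norm_pow]
  have contr : ‖z‖ ^ k * (w ⬝ᵥ fun j => ‖v j‖) ≤ δ * (w ⬝ᵥ fun j => ‖v j‖) := by
    have := hcontr v hwv
    simp only [norm_pow] at this
    rwa [← smul_eq_mul, ← dotProduct_smul]
  exact lt_of_pow_lt_pow_left₀ k h.pos.le ((le_of_mul_le_mul_right contr norm_pos).trans_lt hδ)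

theorem IsPerronTriple.eq_zero_of_mulVec_eq_smul (h : IsPerronTriple A r x w) (hA : A.IsPrimitive)
    {v : n → 𝕜} (hv : A.map (algebraMap ℝ 𝕜) *ᵥ v = (r : 𝕜) • v)
    (hwv : (algebraMap ℝ 𝕜 ∘ w) ⬝ᵥ v = 0) : v = 0 := by
  by_contra hne
  have := h.norm_lt hA hne hv hwv
  rw [RCLike.norm_of_nonneg h.pos.le] at this
  exact lt_irrefl r this

theorem IsPerronTriple.norm_lt_of_isRoot (h : IsPerronTriple A r x w) (hA : A.IsPrimitive) {z : 𝕜}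
    (hz : (A.map (algebraMap ℝ 𝕜)).charpoly.IsRoot z) (hne : z ≠ r) : ‖z‖ < r := by
  rw [← charpoly_toLin', ← Module.End.hasEigenvalue_iff_isRoot_charpoly] at hz
  obtain ⟨v, hv⟩ := hz.exists_hasEigenvector
  have eigen := hv.apply_eq_smul
  rw [toLin'_apply] at eigen
  refine h.norm_lt hA hv.2 eigen ?_
  have := h.dotProduct_map_mulVec v
  rw [eigen, dotProduct_smul, smul_eq_mul] at this
  exact (mul_eq_mul_right_iff.1 this).resolve_left hne

theorem eq_of_mem_stdSimplex_of_mulVec_eq_smul (hA : A.IsPrimitive) (hx : x ∈ stdSimplex ℝ n)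
    (hy : y ∈ stdSimplex ℝ n) (hAx : A *ᵥ x = r • x) (hAy : A *ᵥ y = s • y) : x = y := by
  obtain ⟨t, z, hz, w, h⟩ := exists_isPerronTriple hA
  suffices H : ∀ {y s}, y ∈ stdSimplex ℝ n → A *ᵥ y = s • y → y = z from
    (H hx hAx).trans (H hy hAy).symm
  intro y s hy hAy
  obtain rfl := eigenvalue_eq_of_dotProduct_ne_zero
    (PerronFrobenius.dotProduct_pos h.left_pos hy.1 (ne_zero_of_mem_stdSimplex hy)).ne'
    hAy h.vecMul_eq
  set c := (w ⬝ᵥ y) / (w ⬝ᵥ z)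
  have y_eq : y - c • z = 0 := h.eq_zero_of_mulVec_eq_smul hA (𝕜 := ℝ)
    (by
      have : A *ᵥ (y - c • z) = s • (y - c • z) := by
        rw [mulVec_sub, mulVec_smul, hAy, h.mulVec_eq, smul_sub, smul_comm]
      simpa using this)
    (by
      have : w ⬝ᵥ (y - c • z) = 0 := by
        rw [dotProduct_sub, dotProduct_smul, smul_eq_mul, div_mul_cancel₀ _ h.dotProduct_pos.ne',
          sub_self]
      simpa using this)
  have c_eq : c = 1 := by
    simpa only [sub_eq_zero.1 y_eq, Pi.smul_apply, smul_eq_mul, ← Finset.mul_sum, hz.2, mul_one]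
      using hy.2
  rw [sub_eq_zero.1 y_eq, c_eq, one_smul]

end SpectralGap

section SimpleRoot

theorem maxGenEigenspace_eq_eigenspace {R M : Type*} [CommRing R] [AddCommGroup M] [Module R M]
    {f : Module.End R M} {μ : R} {ℓ : M →ₗ[R] R} (hℓ : ∀ v, ℓ (f v) = μ * ℓ v)
    (hker : ∀ v, f v = μ • v → ℓ v = 0 → v = 0) : f.maxGenEigenspace μ = f.eigenspace μ := by
  set g := f - μ • (1 : Module.End R M) with hg
  have apply_eq_zero (v : M) : ℓ (g v) = 0 := by simp [hg, hℓ]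
  have eq_smul {v : M} (hv : g v = 0) : f v = μ • v := by simpa [hg, sub_eq_zero] using hv
  have ker_pow (k : ℕ) : ∀ v, (g ^ k) v = 0 → g v = 0 := by
    induction k with
    | zero => intro v hv; rw [show v = 0 from hv, map_zero]
    | succ k ih =>
      intro v hv
      rw [pow_succ, Module.End.mul_apply] at hv
      exact hker _ (eq_smul (ih _ hv)) (apply_eq_zero v)
  refine le_antisymm (fun v hv => ?_) (f.genEigenspace_le_maximal μ 1)
  obtain ⟨k, hk⟩ := (f.mem_maxGenEigenspace μ v).1 hv
  exact Module.End.mem_eigenspace_iff.2 (eq_smul (ker_pow k v hk))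

theorem eigenspace_eq_span_singleton {F E : Type*} [Field F] [AddCommGroup E] [Module F E]
    {f : Module.End F E} {μ : F} {x : E} {ℓ : E →ₗ[F] F} (hx : f x = μ • x) (hℓx : ℓ x ≠ 0)
    (hker : ∀ v, f v = μ • v → ℓ v = 0 → v = 0) : f.eigenspace μ = Submodule.span F {x} := by
  have mem_x := Module.End.mem_eigenspace_iff.2 hx
  refine le_antisymm (fun v hv => ?_) ((Submodule.span_singleton_le_iff_mem _ _).2 mem_x)
  refine Submodule.mem_span_singleton.2 ⟨ℓ v / ℓ x, (sub_eq_zero.1 (hker _ ?_ ?_)).symm⟩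
  · exact Module.End.mem_eigenspace_iff.1 (sub_mem hv (Submodule.smul_mem _ _ mem_x))
  · rw [map_sub, map_smul, smul_eq_mul, div_mul_cancel₀ _ hℓx, sub_self]

theorem IsPerronTriple.rootMultiplicity_eq_one {𝕜 : Type*} [RCLike 𝕜] [DecidableEq n] [Nonempty n]
    {A : Matrix n n ℝ} {r : ℝ} {x w : n → ℝ} (h : IsPerronTriple A r x w) (hA : A.IsPrimitive) :
    (A.map (algebraMap ℝ 𝕜)).charpoly.rootMultiplicity (r : 𝕜) = 1 := by
  let ℓ : (n → 𝕜) →ₗ[𝕜] 𝕜 := dotProductBilin 𝕜 𝕜 (algebraMap ℝ 𝕜 ∘ w)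
  have ker_ℓ (v : n → 𝕜) (hv : toLin' (A.map (algebraMap ℝ 𝕜)) v = (r : 𝕜) • v) (hℓ : ℓ v = 0) :
      v = 0 := h.eq_zero_of_mulVec_eq_smul hA hv hℓ
  have eigen : toLin' (A.map (algebraMap ℝ 𝕜)) (algebraMap ℝ 𝕜 ∘ x)
      = (r : 𝕜) • (algebraMap ℝ 𝕜 ∘ x) := by
    ext i
    rw [toLin'_apply, ← RingHom.map_mulVec, h.mulVec_eq]
    simp
  have ℓ_ne_zero : ℓ (algebraMap ℝ 𝕜 ∘ x) ≠ 0 := by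
    change (algebraMap ℝ 𝕜 ∘ w) ⬝ᵥ (algebraMap ℝ 𝕜 ∘ x) ≠ 0
    rw [← RingHom.map_dotProduct]
    exact (map_ne_zero _).2 h.dotProduct_pos.ne'
  rw [← charpoly_toLin', ← LinearMap.finrank_maxGenEigenspace_eq,
    maxGenEigenspace_eq_eigenspace h.dotProduct_map_mulVec ker_ℓ,
    eigenspace_eq_span_singleton eigen ℓ_ne_zero ker_ℓ,
    finrank_span_singleton (ne_of_apply_ne ℓ (by rwa [map_zero]))]

end SimpleRoot

section Perturbation

theorem continuous_of_isClosed_graph {X Y : Type*} [TopologicalSpace X] [TopologicalSpace Y]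
    [CompactSpace Y] {f : X → Y} (hf : IsClosed {q : X × Y | f q.1 = q.2}) : Continuous f := by
  refine continuous_iff_isClosed.2 fun s hs => ?_
  have preimage_eq : f ⁻¹' s = Prod.fst '' ({q : X × Y | f q.1 = q.2} ∩ Prod.snd ⁻¹' s) := by
    ext
    simp
  rw [preimage_eq]
  exact isClosedMap_fst_of_compactSpace _ (hf.inter (hs.preimage continuous_snd))

theorem continuous_of_mulVec_eq_smul {T : Type*} [TopologicalSpace T] [DecidableEq n] [Nonempty n]
    {A : T → Matrix n n ℝ} {r : T → ℝ} {x : T → n → ℝ} (hcont : Continuous A)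
    (hA : ∀ t, (A t).IsPrimitive) (hx : ∀ t, x t ∈ stdSimplex ℝ n)
    (hAx : ∀ t, A t *ᵥ x t = r t • x t) : Continuous x := by
  let z (t : T) : stdSimplex ℝ n := ⟨x t, hx t⟩
  suffices IsClosed {q : T × stdSimplex ℝ n | z q.1 = q.2} from
    continuous_subtype_val.comp (continuous_of_isClosed_graph this)
  have eigenvalue_eq {t : T} {s : ℝ} {y : n → ℝ} (hy : y ∈ stdSimplex ℝ n)
      (h : A t *ᵥ y = s • y) : ∑ i, (A t *ᵥ y) i = s := by
    simp only [h, Pi.smul_apply, smul_eq_mul, ← Finset.mul_sum, hy.2, mul_one]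
  have graph_eq : {q : T × stdSimplex ℝ n | z q.1 = q.2}
      = {q | A q.1 *ᵥ q.2 = (∑ i, (A q.1 *ᵥ q.2) i) • (q.2 : n → ℝ)} := by
    ext ⟨t, y, hy⟩
    refine ⟨fun h => ?_, fun h => Subtype.ext ?_⟩
    · obtain rfl : x t = y := congrArg Subtype.val h
      change A t *ᵥ x t = (∑ i, (A t *ᵥ x t) i) • x t
      rw [eigenvalue_eq (hx t) (hAx t), hAx t]
    · exact eq_of_mem_stdSimplex_of_mulVec_eq_smul (hA t) (hx t) hy (hAx t) h
  have cont : Continuous fun q : T × stdSimplex ℝ n => A q.1 *ᵥ (q.2 : n → ℝ) :=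
    (hcont.comp continuous_fst).matrix_mulVec (continuous_subtype_val.comp continuous_snd)
  rw [graph_eq]
  exact isClosed_eq cont (by fun_prop)

theorem hasDerivAt_eigenvalue {𝕜 : Type*} [NontriviallyNormedField 𝕜] {A : 𝕜 → Matrix n n 𝕜}
    {A' : Matrix n n 𝕜} {r : 𝕜 → 𝕜} {x : 𝕜 → n → 𝕜} {w : n → 𝕜} {t₀ : 𝕜}
    (hA : ∀ i j, HasDerivAt (fun t => A t i j) (A' i j) t₀) (hx : ContinuousAt x t₀)
    (hAx : ∀ t, A t *ᵥ x t = r t • x t) (hw : w ᵥ* A t₀ = r t₀ • w) (hwx : w ⬝ᵥ x t₀ ≠ 0) :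
    HasDerivAt r ((w ⬝ᵥ (A' *ᵥ x t₀)) / (w ⬝ᵥ x t₀)) t₀ := by
  have slope_eq (t : 𝕜) (ht : w ⬝ᵥ x t ≠ 0) :
      (w ⬝ᵥ (slope A t₀ t *ᵥ x t)) / (w ⬝ᵥ x t) = slope r t₀ t := by
    have : w ⬝ᵥ (A t₀ *ᵥ x t) = r t₀ * (w ⬝ᵥ x t) := by
      rw [dotProduct_mulVec, hw, smul_dotProduct, smul_eq_mul]
    simp only [slope, vsub_eq_sub, smul_mulVec, dotProduct_smul, sub_mulVec, dotProduct_sub, hAx,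
      this, smul_eq_mul, ← sub_mul, ← mul_assoc, mul_div_cancel_right₀ _ ht]
  have tendsto_slope : Tendsto (slope A t₀) (𝓝[≠] t₀) (𝓝 A') :=
    tendsto_pi_nhds.2 fun i => tendsto_pi_nhds.2 fun j => (hA i j).tendsto_slope
  have tendsto_x := hx.tendsto.mono_left (nhdsWithin_le_nhds (s := {t₀}ᶜ))
  have tendsto_dotProduct : Tendsto (fun t => w ⬝ᵥ x t) (𝓝[≠] t₀) (𝓝 (w ⬝ᵥ x t₀)) :=
    ((continuous_const.dotProduct continuous_id).tendsto _).comp tendsto_x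
  have cont : Continuous fun q : Matrix n n 𝕜 × (n → 𝕜) => w ⬝ᵥ (q.1 *ᵥ q.2) :=
    continuous_const.dotProduct (continuous_fst.matrix_mulVec continuous_snd)
  refine hasDerivAt_iff_tendsto_slope.2 <| Tendsto.congr' ?_ <|
    ((cont.tendsto (A', x t₀)).comp (tendsto_slope.prodMk_nhds tendsto_x)).div
      tendsto_dotProduct hwx
  filter_upwards [tendsto_dotProduct.eventually_ne hwx] with t ht using slope_eq t ht

end Perturbation

end PerronFrobenius

namespace MarkovBoxes

open Matrix PerronFrobenius LargeDeviations

variable {K : ℕ} {p : Matrix (Fin K) (Fin K) ℝ}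

theorem isPrimitive_of_isAperiodic (hirr : p.IsIrreducible) (haper : IsAperiodic p) :
    p.IsPrimitive :=
  isPrimitive_of_isIrreducible hirr fun i =>
    haper i _ fun _ _ hm => Nat.setGcd_dvd_of_mem hm

section Perron

theorem powMatrix_one (p : Matrix (Fin K) (Fin K) ℝ) : powMatrix p 1 = p := by
  ext i j
  simp +contextual [powMatrix]

theorem powMatrix_nonneg (hp : ∀ i j, 0 ≤ p i j) (θ : ℝ) (i j : Fin K) :
    0 ≤ powMatrix p θ i j := by
  rw [powMatrix, of_apply]
  split_ifs
  exacts [le_rfl, Real.rpow_nonneg (hp i j) θ]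

theorem isPrimitive_powMatrix (hp : p.IsPrimitive) (θ : ℝ) : (powMatrix p θ).IsPrimitive :=
  isPrimitive_of_pos_imp hp (powMatrix_nonneg hp.nonneg θ) fun i j h => by
    rw [powMatrix, of_apply, if_neg h.ne']
    exact Real.rpow_pos_of_pos h θ

theorem differentiable_powMatrix_apply (p : Matrix (Fin K) (Fin K) ℝ) (i j : Fin K) :
    Differentiable ℝ fun θ => powMatrix p θ i j := by
  by_cases h : p i j = 0
  · simp [powMatrix, h]
  · simp only [powMatrix, of_apply, h, if_false]
    exact fun θ => (differentiableAt_const _).rpow differentiableAt_id h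

variable [Nonempty (Fin K)]

theorem isMaxModulusEigenvalue_of_isPerronTriple {A : Matrix (Fin K) (Fin K) ℝ} {r : ℝ}
    {x w : Fin K → ℝ} (h : IsPerronTriple A r x w) (hA : A.IsPrimitive) :
    IsMaxModulusEigenvalue A r :=
  ⟨h.rootMultiplicity_eq_one hA, fun z hz hne => by
    rw [abs_of_pos h.pos]
    exact h.norm_lt_of_isRoot hA hz hne⟩

theorem exists_isPerronTriple_rho (hp : p.IsPrimitive) (θ : ℝ) :
    ∃ x ∈ stdSimplex ℝ (Fin K), ∃ w, IsPerronTriple (powMatrix p θ) (rho p θ) x w := by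
  have hA := isPrimitive_powMatrix hp θ
  obtain ⟨r, x, hx, w, h⟩ := exists_isPerronTriple hA
  have hr := isMaxModulusEigenvalue_of_isPerronTriple h hA
  have rho_eq : rho p θ = r := (Classical.epsilon_spec ⟨r, hr⟩).unique hr
  exact ⟨x, hx, w, rho_eq ▸ h⟩

theorem isMaxModulusEigenvalue_rho (hp : p.IsPrimitive) (θ : ℝ) :
    IsMaxModulusEigenvalue (powMatrix p θ) (rho p θ) :=
  let ⟨_, _, _, h⟩ := exists_isPerronTriple_rho hp θ
  isMaxModulusEigenvalue_of_isPerronTriple h (isPrimitive_powMatrix hp θ)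

theorem rho_pos (hp : p.IsPrimitive) (θ : ℝ) : 0 < rho p θ :=
  let ⟨_, _, _, h⟩ := exists_isPerronTriple_rho hp θ
  h.pos

theorem differentiable_rho (hp : p.IsPrimitive) : Differentiable ℝ (rho p) := fun θ => by
  choose x hx w h using exists_isPerronTriple_rho hp
  have cont_powMatrix : Continuous (powMatrix p) :=
    continuous_matrix fun i j => (differentiable_powMatrix_apply p i j).continuous
  have cont_x : Continuous x := continuous_of_mulVec_eq_smul cont_powMatrix
    (isPrimitive_powMatrix hp) hx fun t => (h t).mulVec_eq
  exact (hasDerivAt_eigenvalue (A' := of fun i j => deriv (fun t => powMatrix p t i j) θ)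
    (fun i j => (differentiable_powMatrix_apply p i j θ).hasDerivAt) cont_x.continuousAt
    (fun t => (h t).mulVec_eq) (h θ).vecMul_eq (h θ).dotProduct_pos.ne').differentiableAt

theorem rho_one (hp : p.IsPrimitive) (hstoch : p ∈ rowStochastic ℝ (Fin K)) : rho p 1 = 1 := by
  obtain ⟨x, -, w, h⟩ := exists_isPerronTriple_rho hp 1
  refine (eigenvalue_eq_of_dotProduct_ne_zero (x := 1)
    (dotProduct_pos h.left_pos zero_le_one one_ne_zero).ne' ?_ h.vecMul_eq).symm
  rw [powMatrix_one, one_vecMul_of_mem_rowStochastic hstoch, one_smul]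

end Perron

section Boxes

theorem boxSize_nonneg (hp : ∀ i j, 0 ≤ p i j) (i₀ : Fin K) :
    ∀ (n : ℕ) (u : Fin n → Fin K), 0 ≤ boxSize p i₀ n u
  | 0, _ => zero_le_one
  | n + 1, u => mul_nonneg (boxSize_nonneg hp i₀ n (Fin.init u)) (hp _ _)

theorem boxSize_powMatrix (hp : ∀ i j, 0 ≤ p i j) (i₀ : Fin K) (τ : ℝ) :
    ∀ (n : ℕ) (u : Fin n → Fin K), boxSize (powMatrix p τ) i₀ n u
      = if boxSize p i₀ n u = 0 then 0 else boxSize p i₀ n u ^ τ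
  | 0, _ => by simp [boxSize]
  | n + 1, u => by
    rw [boxSize, boxSize_powMatrix hp i₀ τ n, boxSize, powMatrix, of_apply,
      Real.mul_rpow (boxSize_nonneg hp i₀ n _) (hp _ _)]
    simp only [mul_eq_zero, ite_or, mul_ite, ite_mul, mul_zero, zero_mul]
    split_ifs <;> rfl

theorem sum_boxSize_mul (p : Matrix (Fin K) (Fin K) ℝ) (i₀ : Fin K) (n : ℕ) (x : Fin K → ℝ) :
    ∑ u : Fin n → Fin K, boxSize p i₀ n u * x (boxType i₀ n u) = (p ^ n *ᵥ x) i₀ := by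
  induction n generalizing x with
  | zero => simp [boxSize, boxType]
  | succ n ih =>
    rw [← (Fin.snocEquiv fun _ => Fin K).sum_comp, Fintype.sum_prod_type_right, pow_succ,
      ← mulVec_mulVec, ← ih]
    refine Finset.sum_congr rfl fun u _ => ?_
    rw [mulVec, dotProduct, Finset.mul_sum]
    refine Finset.sum_congr rfl fun k _ => ?_
    have init_eq : Fin.init (Fin.snocEquiv (fun _ => Fin K) (k, u)) = u :=
      Fin.init_snoc (α := fun _ => Fin K) k u
    have last_eq : Fin.snocEquiv (fun _ => Fin K) (k, u) (Fin.last n) = k :=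
      Fin.snoc_last (α := fun _ => Fin K) k u
    rw [boxSize, boxType, init_eq, last_eq, mul_assoc]

theorem sum_boxSize (p : Matrix (Fin K) (Fin K) ℝ) (i₀ : Fin K) (n : ℕ) :
    ∑ u : Fin n → Fin K, boxSize p i₀ n u = (p ^ n *ᵥ 1) i₀ := by
  simpa using sum_boxSize_mul p i₀ n 1

end Boxes

section SizeBiasedPick

instance isFiniteMeasure_sizeBiasedPick (p : Matrix (Fin K) (Fin K) ℝ) (i₀ : Fin K) (n : ℕ) :
    IsFiniteMeasure (sizeBiasedPick p i₀ n) :=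
  ⟨by simp [sizeBiasedPick, Measure.finsetSum_apply, ENNReal.sum_lt_top]⟩

theorem integral_sizeBiasedPick (hp : ∀ i j, 0 ≤ p i j) (i₀ : Fin K) (n : ℕ)
    (f : (Fin n → Fin K) → ℝ) :
    ∫ u, f u ∂sizeBiasedPick p i₀ n = ∑ u, boxSize p i₀ n u * f u := by
  rw [sizeBiasedPick, integral_finsetSum_measure fun u _ =>
    Integrable.of_finite.smul_measure ENNReal.ofReal_ne_top]
  refine Finset.sum_congr rfl fun u _ => ?_
  rw [integral_smul_measure, integral_dirac, ENNReal.toReal_ofReal (boxSize_nonneg hp i₀ n u),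
    smul_eq_mul]

open Classical in
theorem measureReal_sizeBiasedPick (hp : ∀ i j, 0 ≤ p i j) (i₀ : Fin K) (n : ℕ)
    (S : Set (Fin n → Fin K)) :
    (sizeBiasedPick p i₀ n).real S = ∑ u with u ∈ S, boxSize p i₀ n u := by
  rw [← integral_indicator_one (Set.toFinite S).measurableSet, integral_sizeBiasedPick hp,
    Finset.sum_filter]
  simp only [Set.indicator_apply, Pi.one_apply, mul_ite, mul_one, mul_zero]

theorem isProbabilityMeasure_sizeBiasedPick (hstoch : p ∈ rowStochastic ℝ (Fin K)) (i₀ : Fin K)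
    (n : ℕ) : IsProbabilityMeasure (sizeBiasedPick p i₀ n) := by
  classical
  rw [isProbabilityMeasure_iff_real,
    measureReal_sizeBiasedPick (p := p) fun i j => nonneg_of_mem_rowStochastic hstoch]
  simp only [Set.mem_univ, Finset.filter_true, sum_boxSize,
    one_vecMul_of_mem_rowStochastic (pow_mem hstoch n), Pi.one_apply]

theorem mgf_log_boxSize (hp : ∀ i j, 0 ≤ p i j) (i₀ : Fin K) (τ s : ℝ) (n : ℕ) :
    mgf (fun u => Real.log (boxSize p i₀ n u)) (sizeBiasedPick (powMatrix p τ) i₀ n) s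
      = (powMatrix p (τ + s) ^ n *ᵥ 1) i₀ := by
  rw [mgf, integral_sizeBiasedPick (powMatrix_nonneg hp τ), ← sum_boxSize]
  refine Finset.sum_congr rfl fun u _ => ?_
  rw [boxSize_powMatrix hp, boxSize_powMatrix hp]
  split_ifs with h
  · rw [zero_mul]
  · have pos := (boxSize_nonneg hp i₀ n u).lt_of_ne' h
    rw [Real.rpow_add pos, mul_comm s, ← Real.rpow_def_of_pos pos]

theorem hasLimitingCGF_log_boxSize [Nonempty (Fin K)] (hp : p.IsPrimitive) (i₀ : Fin K) (τ : ℝ) :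
    HasLimitingCGF (fun n u => Real.log (boxSize p i₀ n u))
      (fun n => sizeBiasedPick (powMatrix p τ) i₀ n) fun s => Real.log (rho p (τ + s)) := by
  intro s
  obtain ⟨x, -, w, h⟩ := exists_isPerronTriple_rho hp (τ + s)
  simpa only [mgf_log_boxSize hp.nonneg] using
    h.hasExpGrowth_pow_mulVec_one (powMatrix_nonneg hp.nonneg _) i₀

end SizeBiasedPick

section Windows

open Classical in
/-- The sum of the powers `s ^ τ` of the sizes `s` of the boxes of generation `n` lying in
`sizeWindow p θ ε n`. It is `windowProb` for `τ = 1` and `windowCount` for `τ = 0`. -/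
noncomputable def windowMoment (p : Matrix (Fin K) (Fin K) ℝ) (i₀ : Fin K) (τ θ ε : ℝ) (n : ℕ) :
    ℝ :=
  ∑ u with boxSize p i₀ n u ∈ sizeWindow p θ ε n, boxSize p i₀ n u ^ τ

theorem mem_sizeWindow_iff {θ ε s : ℝ} {n : ℕ} (hs : 0 < s) :
    s ∈ sizeWindow p θ ε n ↔ Real.log s ∈ Set.Ioo (n * (deriv (rho p) θ / rho p θ - ε))
      (n * (deriv (rho p) θ / rho p θ + ε)) := by
  rw [sizeWindow, ← Real.exp_add, ← Real.exp_add, mul_sub, mul_add, ← sub_eq_add_neg, Set.mem_Ioo,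
    Set.mem_Ioo, Real.lt_log_iff_exp_lt hs, Real.log_lt_iff_lt_exp hs]

-- A box of size `0` has `log 0 = 0`, which may lie in the interval, but its mass is `0`.
theorem measureReal_log_boxSize_eq_windowMoment (hp : ∀ i j, 0 ≤ p i j) (i₀ : Fin K)
    (τ θ ε : ℝ) (n : ℕ) :
    (sizeBiasedPick (powMatrix p τ) i₀ n).real ((fun u => Real.log (boxSize p i₀ n u)) ⁻¹'
      Set.Ioo (n * (deriv (rho p) θ / rho p θ - ε)) (n * (deriv (rho p) θ / rho p θ + ε)))
      = windowMoment p i₀ τ θ ε n := by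
  classical
  rw [measureReal_sizeBiasedPick (powMatrix_nonneg hp τ), windowMoment, Finset.sum_filter,
    Finset.sum_filter]
  refine Finset.sum_congr rfl fun u _ => ?_
  rw [boxSize_powMatrix hp, Set.mem_preimage]
  rcases (boxSize_nonneg hp i₀ n u).eq_or_lt' with h | h
  · have : (0 : ℝ) ∉ sizeWindow p θ ε n := fun h0 =>
      (mul_pos (Real.exp_pos _) (Real.exp_pos _)).not_gt h0.1
    rw [h, if_neg this, if_pos rfl, ite_self]
  · rw [mem_sizeWindow_iff h, if_neg h.ne']

theorem windowProb_eq_windowMoment (hp : ∀ i j, 0 ≤ p i j) (i₀ : Fin K) (θ : ℝ) :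
    windowProb p i₀ θ = windowMoment p i₀ 1 θ := by
  ext ε n
  simp only [windowProb, measureReal_sizeBiasedPick hp, Set.mem_ofPred_eq, windowMoment,
    Real.rpow_one]

theorem windowCount_eq_windowMoment (p : Matrix (Fin K) (Fin K) ℝ) (i₀ : Fin K) (θ ε : ℝ)
    (n : ℕ) :
    windowCount p i₀ θ ε n = windowMoment p i₀ 0 θ ε n := by
  classical
  simp [windowCount, windowMoment, Set.ncard_eq_toFinset_card', Set.toFinset_ofPred]

variable [Nonempty (Fin K)]

theorem hasDerivAt_log_rho_add (hp : p.IsPrimitive) (τ θ : ℝ) :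
    HasDerivAt (fun s => Real.log (rho p (τ + s))) (deriv (rho p) θ / rho p θ) (θ - τ) := by
  have := ((differentiable_rho hp θ).hasDerivAt.log (rho_pos hp θ).ne')
  exact HasDerivAt.comp_const_add τ (θ - τ) (by rwa [add_sub_cancel])

theorem log_rho_sub_mul_le (hp : p.IsPrimitive) (τ θ : ℝ) :
    Real.log (rho p θ) - (θ - τ) * (deriv (rho p) θ / rho p θ) ≤ Real.log (rho p τ) := by
  simpa using (hasLimitingCGF_log_boxSize hp (Classical.arbitrary _) τ).sub_mul_deriv_le
    (hasDerivAt_log_rho_add hp τ θ) 0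

theorem hasExpRate_windowMoment (hp : p.IsPrimitive) (i₀ : Fin K) (τ θ : ℝ) :
    HasExpRate (windowMoment p i₀ τ θ)
      (Real.log (rho p θ) - (θ - τ) * (deriv (rho p) θ / rho p θ)) := by
  have diff : Differentiable ℝ fun s => Real.log (rho p (τ + s)) := fun s => by
    have := (hasDerivAt_log_rho_add hp τ (τ + s)).differentiableAt
    rwa [add_sub_cancel_left] at this
  have rate := (hasLimitingCGF_log_boxSize hp i₀ τ).hasExpRate diff (θ - τ)
  simpa only [(hasDerivAt_log_rho_add hp τ θ).deriv, add_sub_cancel,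
    measureReal_log_boxSize_eq_windowMoment hp.nonneg] using rate

end Windows

end MarkovBoxes

theorem mainTheorem7 {K : ℕ} (p : Matrix (Fin K) (Fin K) ℝ)
    (hstoch : p ∈ Matrix.rowStochastic ℝ (Fin K))
    (hirr : p.IsIrreducible) (haper : MarkovBoxes.IsAperiodic p)
    (i₀ : Fin K) (θ : ℝ) :
    (MarkovBoxes.IsMaxModulusEigenvalue (MarkovBoxes.powMatrix p θ) (MarkovBoxes.rho p θ) ∧
      0 < MarkovBoxes.rho p θ ∧ DifferentiableAt ℝ (MarkovBoxes.rho p) θ) ∧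
    (∀ n : ℕ, IsProbabilityMeasure (MarkovBoxes.sizeBiasedPick p i₀ n)) ∧
    MarkovBoxes.phi p θ ≤ 0 ∧
    MarkovBoxes.HasExpRate (MarkovBoxes.windowProb p i₀ θ) (MarkovBoxes.phi p θ) ∧
    MarkovBoxes.HasExpRate (fun ε n => (MarkovBoxes.windowCount p i₀ θ ε n : ℝ))
      (MarkovBoxes.psi p θ) := by
  have : Nonempty (Fin K) := ⟨i₀⟩
  have hp := MarkovBoxes.isPrimitive_of_isAperiodic hirr haper
  refine ⟨⟨MarkovBoxes.isMaxModulusEigenvalue_rho hp θ, MarkovBoxes.rho_pos hp θ,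
    MarkovBoxes.differentiable_rho hp θ⟩,
    MarkovBoxes.isProbabilityMeasure_sizeBiasedPick hstoch i₀, ?_, ?_, ?_⟩
  · simpa only [MarkovBoxes.phi, MarkovBoxes.rho_one hp hstoch, Real.log_one] using
      MarkovBoxes.log_rho_sub_mul_le hp 1 θ
  · rw [MarkovBoxes.windowProb_eq_windowMoment hp.nonneg]
    exact MarkovBoxes.hasExpRate_windowMoment hp i₀ 1 θ
  · simpa only [MarkovBoxes.psi, MarkovBoxes.windowCount_eq_windowMoment, sub_zero] using
      MarkovBoxes.hasExpRate_windowMoment hp i₀ 0 θ
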